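/- Conventions. A hypergraph $\mathcal H$ consists of a finite vertex set $V(\mathcal H)$ and a set $E(\mathcal H)$ of subsets of it, the hyperedges; it is $3$-uniform if all hyperedges have size $3$. We say that $\mathcal H$ contains a hypergraph $\mathcal G$ as a trace if there is $S\subseteq V(\mathcal H)$ with $|S|=|V(\mathcal G)|$ such that the hypergraph on $S$ with hyperedge set $\{e\cap S : e\in E(\mathcal H)\}$ contains a sub-hypergraph isomorphic to $\mathcal G$. Let $M_{s+1}$ be the graph consisting of $s+1$ pairwise disjoint edges (on $2s+2$ vertices), let $\mathcal K_t^3$ be the complete $3$-uniform hypergraph on $t$ vertices, and let $k_t^3(\mathcal H)$ be the number of sub-hypergraphs of $\mathcal H$ isomorphic to $\mathcal K_t^3$. Theorem. Let $4\le t\le s$ be integers. (i) There is $N=N(s,t)$ such that for every $n\ge N$, every $3$-uniform hypergraph $\mathcal H$ on $n$ vertices that does not contain $M_{s+1}$ as a trace satisfies $$k_t^3(\mathcal H)\le \binom{s+1}{t-1}(n-s-1)+\binom{s+1}{t}.$$ (ii) The bound is attained. For $n\ge s+1$, let $V$ be a set of $n$ vertices, let $U\subseteq V$ with $|U|=s+1$,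 and let $\mathcal H$ be the hypergraph on $V$ whose hyperedges are all sets $\{v\}\cup p$ with $v\in V\setminus U$ and $p\subseteq U$, $|p|=2$, together with all $3$-element subsets of $U$. Then $\mathcal H$ is $3$-uniform, does not contain $M_{s+1}$ as a trace, and $k_t^3(\mathcal H)=\binom{s+1}{t-1}(n-s-1)+\binom{s+1}{t}$. -/

import Mathlib

universe u

namespace TraceTuran

/-- A hypergraph is `r`-uniform if all its hyperedges have size `r`. -/
def IsUniform {α : Type*} (H : Hypergraph α) (r : ℕ) : Prop :=
  ∀ e ∈ H.edgeSet, e.encard = r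

/-- `K` is a sub-hypergraph of `H` (not necessarily induced). -/
def IsSub {α : Type*} (K H : Hypergraph α) : Prop :=
  K.vertexSet ⊆ H.vertexSet ∧ K.edgeSet ⊆ H.edgeSet

/-- The copies of `G` in `H`: the sub-hypergraphs of `H` that are isomorphic to `G`,
i.e. that are the image of `G` under a map injective on the vertices of `G`. -/
def copies {α β : Type*} (G : Hypergraph β) (H : Hypergraph α) : Set (Hypergraph α) :=
  {K | IsSub K H ∧ ∃ f : β → α, Set.InjOn f G.vertexSet ∧ K = G.image f}

/-- The number of copies of `G` in `H` (meant for `H` with finitely many vertices, where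
the set of copies is finite). -/
noncomputable def numCopies {α β : Type*} (G : Hypergraph β) (H : Hypergraph α) : ℕ :=
  (copies G H).ncard

/-- The trace of `H` on a vertex subset `S`: the hypergraph on `S` with hyperedges `e ∩ S`,
`e` running over the hyperedges of `H`. -/
def trace {α : Type*} (H : Hypergraph α) (S : Set α) : Hypergraph α where
  vertexSet := S
  edgeSet := {e' | ∃ e ∈ H.edgeSet, e' = e ∩ S}
  subset_vertexSet_of_mem_edgeSet' := by
    rintro _ ⟨e, _, rfl⟩
    exact Set.inter_subset_right

/-- `H` contains `G` as a trace: for some vertex subset `S` with `|S| = v(G)`, the trace of `H`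
on `S` contains a copy of `G`. -/
def ContainsAsTrace {α β : Type*} (H : Hypergraph α) (G : Hypergraph β) : Prop :=
  ∃ S ⊆ H.vertexSet, S.encard = G.vertexSet.encard ∧ (copies G (trace H S)).Nonempty

/-- The matching `M_m`, consisting of the `m` independent edges `{(i, 0), (i, 1)}`. -/
def matching (m : ℕ) : Hypergraph (Fin m × Fin 2) where
  vertexSet := Set.univ
  edgeSet := {e | ∃ i : Fin m, e = {(i, 0), (i, 1)}}
  subset_vertexSet_of_mem_edgeSet' := fun _ _ => Set.subset_univ _

/-- The complete `r`-uniform hypergraph on the vertex set `U`. -/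
def completeUniformOn {α : Type*} (U : Set α) (r : ℕ) : Hypergraph α where
  vertexSet := U
  edgeSet := {e | e ⊆ U ∧ e.encard = r}
  subset_vertexSet_of_mem_edgeSet' := fun _ h => h.1

/-- The complete `r`-uniform hypergraph `K_t^r` on `t` vertices. -/
def completeUniform (t r : ℕ) : Hypergraph (Fin t) := completeUniformOn Set.univ r

/-- The 3-uniform hypergraph on `V ⊇ U` whose hyperedges are the sets `{v} ∪ p` with `v ∈ V \ U`
and `p` an edge of the complete graph on `U`, together with all 3-subsets of `U`. -/
def cliqueConstruction {α : Type*} (V U : Set α) (hUV : U ⊆ V) : Hypergraph α where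
  vertexSet := V
  edgeSet := {e | (∃ v ∈ V \ U, ∃ p ∈ (completeUniformOn U 2).edgeSet, e = insert v p) ∨
    e ∈ (completeUniformOn U 3).edgeSet}
  subset_vertexSet_of_mem_edgeSet' := by
    rintro e (⟨v, hv, p, hp, rfl⟩ | he)
    · exact Set.insert_subset hv.1 (hp.1.trans hUV)
    · exact he.1.trans hUV

end TraceTuran

/-!
The idea. Let `F` be the family of vertex sets of copies of `𝒦_t^3` in `H`, and call a `(t - 1)`-set
heavy if it extends to a member of `F` by many vertices. In a sunflower of members of `F` whose
petals have at least two vertices, each petal contributes a pair that some further vertex of the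
same clique completes to a hyperedge, so such a sunflower has at most `s` petals
(`card_sunflower_le`). By the sunflower lemma all but a bounded number of members of `F` contain a
heavy set, whence `#F ≤ #heavy * n + O(1)` (`card_tripleCliques_le`).

It remains to count heavy sets. They are cliques of the graph joining two vertices of a common heavy
set. If this graph had a star forest with `s + 1` leaves, each leaf could be matched with a new
vertex extending a heavy set that contains the leaf and its centre, and the centre, being left out,
would turn these pairs into a matching in a trace (`starForestBound_heavyGraph`). The
key fact is the graph theorem `StarForestBound.card_cliquesIn_le`: without a star forest of more than
`s` edges there are at most `C(s + 1, t - 1)` cliques with `t - 1 ≥ 3` vertices, and equality forces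
all of them into one set `U` of `s + 1` vertices. It is proved by induction, deleting a vertex `x` of
maximum degree and its neighbourhood `A`: with `b = s + 1 - #A`, each vertex of `A` has at most `b`
neighbours in the rest `R`, and `R` satisfies the star forest bound with `s - #A`, so that
Vandermonde's identity bounds the cliques missing `x`; those through `x` are paid for
by the non-neighbours in `A` that a vertex of `A` with neighbours in `R` must have
(`card_le_card_nonclique`).

So either there are fewer than `C(s + 1, t - 1)` heavy sets, and the bound holds for large `n`, or
the heavy sets are exactly the `(t - 1)`-subsets of `U`. In that case no clique has two vertices
outside `U` (`card_sdiff_le_one_of_heavySets_eq`), and the number of such sets is exactly the bound.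
In the extremal construction these sets are exactly the cliques, and a matching in a trace would use
each vertex of `U` once, hence an edge whose hyperedge has two vertices outside `U`.
-/

namespace TraceTuran

open Finset
open scoped Classical

/-! ### Cliques in graphs without large star forests -/

/-- The `k`-cliques of the graph `G` with all vertices in `V`. -/
noncomputable def cliquesIn {α : Type*} (G : SimpleGraph α) (V : Finset α) (k : ℕ) :
    Finset (Finset α) :=
  {T ∈ V.powersetCard k | G.IsClique (T : Set α)}

/-- Every star forest of `G` inside `V` has at most `s` edges. A star forest is encoded by its set
`B` of leaves, each of which has a neighbour (its centre) in `V` outside `B`. -/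
def StarForestBound {α : Type*} (G : SimpleGraph α) (V : Finset α) (s : ℕ) : Prop :=
  ∀ B ⊆ V, (∀ b ∈ B, ∃ d ∈ V \ B, G.Adj b d) → #B ≤ s

section Graph

variable {α : Type*} {G : SimpleGraph α} {V A R : Finset α} {m k s b : ℕ}

lemma mem_cliquesIn {T : Finset α} :
    T ∈ cliquesIn G V k ↔ (T ⊆ V ∧ #T = k) ∧ G.IsClique (T : Set α) := by
  simp [cliquesIn]

/-- If every vertex of a clique in `𝒬` has a non-neighbour in `A`, then there are at least as many
non-cliques with one more vertex. Each `Q ∈ 𝒬` is paired with the two sets arising from it by adding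
a non-neighbour of one of two chosen vertices of `Q`; no non-clique arises more than twice. -/
lemma card_le_card_nonclique (hm : 2 ≤ m) (𝒬 : Finset (Finset α)) (h𝒬 : 𝒬 ⊆ cliquesIn G A m)
    (hne : ∀ Q ∈ 𝒬, ∀ q ∈ Q, ∃ u ∈ A, u ≠ q ∧ ¬ G.Adj q u) :
    #𝒬 ≤ #(A.powersetCard (m + 1) \ cliquesIn G A (m + 1)) := by
  rcases 𝒬.eq_empty_or_nonempty with rfl | ⟨Q₀, hQ₀⟩
  · simp
  have : Nonempty α := by
    have := (mem_cliquesIn.1 (h𝒬 hQ₀)).1.2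
    exact (card_pos.1 (by omega : 0 < #Q₀)).to_subtype.map Subtype.val
  have hsel : ∀ Q ∈ 𝒬, ∃ q u : Bool → α, q true ≠ q false ∧
      ∀ i, q i ∈ Q ∧ u i ∈ A ∧ u i ≠ q i ∧ ¬ G.Adj (q i) (u i) := by
    intro Q hQ
    have h2 : 1 < #Q := by
      have := (mem_cliquesIn.1 (h𝒬 hQ)).1.2
      omega
    obtain ⟨a, ha, c, hc, hac⟩ := one_lt_card.1 h2
    obtain ⟨u, hu⟩ := hne Q hQ a ha
    obtain ⟨v, hv⟩ := hne Q hQ c hc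
    refine ⟨fun i => if i then a else c, fun i => if i then u else v, by simpa, ?_⟩
    rintro (_ | _) <;> simp <;> tauto
  choose! q u hq hu using hsel
  have hadj : ∀ Q ∈ 𝒬, ∀ y ∈ Q, ∀ z ∈ Q, y ≠ z → G.Adj y z := fun Q hQ y hy z hz hyz =>
    (mem_cliquesIn.1 (h𝒬 hQ)).2 (mem_coe.2 hy) (mem_coe.2 hz) hyz
  have hnot : ∀ Q ∈ 𝒬, ∀ i, u Q i ∉ Q := fun Q hQ i hi =>
    (hu Q hQ i).2.2.2 (hadj Q hQ _ (hu Q hQ i).1 _ hi (hu Q hQ i).2.2.1.symm)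
  -- two different cliques with the same extension miss the edge between their two new vertices
  have key : ∀ Q ∈ 𝒬, ∀ Q' ∈ 𝒬, ∀ i i', insert (u Q i) Q = insert (u Q' i') Q' → Q ≠ Q' →
      q Q i = u Q' i' := by
    intro Q hQ Q' hQ' i i' h hne
    by_contra hcon
    have huu : u Q i ≠ u Q' i' := by
      intro huu
      apply hne
      rw [← erase_insert (hnot Q hQ i), h, huu, erase_insert (hnot Q' hQ' i')]
    have h1 : q Q i ∈ Q' := by
      have : q Q i ∈ insert (u Q' i') Q' := h ▸ mem_insert_of_mem (hu Q hQ i).1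
      exact (mem_insert.1 this).resolve_left hcon
    have h2 : u Q i ∈ Q' := by
      have : u Q i ∈ insert (u Q' i') Q' := h ▸ mem_insert_self _ _
      exact (mem_insert.1 this).resolve_left huu
    exact (hu Q hQ i).2.2.2 (hadj Q' hQ' _ h1 _ h2 (hu Q hQ i).2.2.1.symm)
  have hqi : ∀ Q ∈ 𝒬, ∀ i i', q Q i = q Q i' → i = i' := by
    intro Q hQ i i' h
    have := hq Q hQ
    cases i <;> cases i' <;> simp_all
  set f : Finset α × Bool → Finset α := fun p => insert (u p.1 p.2) p.1 with hf
  have hmaps : ∀ p ∈ 𝒬 ×ˢ (univ : Finset Bool),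
      f p ∈ A.powersetCard (m + 1) \ cliquesIn G A (m + 1) := by
    rintro ⟨Q, i⟩ hp
    have hQ : Q ∈ 𝒬 := (mem_product.1 hp).1
    have hQ' := mem_cliquesIn.1 (h𝒬 hQ)
    simp only [hf, mem_sdiff, mem_powersetCard, mem_cliquesIn]
    refine ⟨⟨insert_subset (hu Q hQ i).2.1 hQ'.1.1, ?_⟩, fun hcl => ?_⟩
    · rw [card_insert_of_notMem (hnot Q hQ i), hQ'.1.2]
    · refine (hu Q hQ i).2.2.2 (hcl.2 ?_ ?_ (hu Q hQ i).2.2.1.symm)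
      · simp [(hu Q hQ i).1]
      · simp
  have hfib : ∀ K ∈ A.powersetCard (m + 1) \ cliquesIn G A (m + 1),
      #{p ∈ 𝒬 ×ˢ (univ : Finset Bool) | f p = K} ≤ 2 := by
    intro K _
    by_cases hex : ∃ p ∈ 𝒬 ×ˢ (univ : Finset Bool), ∃ p' ∈ 𝒬 ×ˢ (univ : Finset Bool),
        f p = K ∧ f p' = K ∧ p.1 ≠ p'.1
    · obtain ⟨⟨Q, i⟩, hp, ⟨Q', i'⟩, hp', h, h', hne⟩ := hex
      have hQ : Q ∈ 𝒬 := (mem_product.1 hp).1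
      have hQ' : Q' ∈ 𝒬 := (mem_product.1 hp').1
      have hsub : ({p ∈ 𝒬 ×ˢ (univ : Finset Bool) | f p = K} : Finset _) ⊆ {(Q, i), (Q', i')} := by
        rintro ⟨Q₁, j⟩ hp₁
        obtain ⟨hp₁, h₁⟩ := mem_filter.1 hp₁
        have hQ₁ : Q₁ ∈ 𝒬 := (mem_product.1 hp₁).1
        simp only [hf] at h h' h₁ hne
        have e1 := key Q hQ Q' hQ' i i' (h.trans h'.symm) hne
        have e2 := key Q' hQ' Q hQ i' i (h'.trans h.symm) hne.symm
        by_cases hc : Q₁ = Q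
        · subst hc
          have e3 := key Q₁ hQ Q' hQ' j i' (h₁.trans h'.symm) hne
          have := hqi Q₁ hQ j i (e3.trans e1.symm)
          simp [this]
        · have e3 := key Q hQ Q₁ hQ₁ i j (h.trans h₁.symm) (Ne.symm hc)
          have e4 := key Q₁ hQ₁ Q hQ j i (h₁.trans h.symm) hc
          have hQQ : Q₁ = Q' := by
            rw [← erase_insert (hnot Q₁ hQ₁ j), h₁, ← h', ← e3, e1, erase_insert (hnot Q' hQ' i')]
          subst hQQ
          have := hqi Q₁ hQ₁ j i' (e4.trans e2.symm)
          simp [this]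
      exact (card_le_card hsub).trans card_le_two
    · push Not at hex
      have : Set.InjOn Prod.snd
          (({p ∈ 𝒬 ×ˢ (univ : Finset Bool) | f p = K} : Finset _) : Set (Finset α × Bool)) := by
        intro p hp p' hp' h
        simp only [coe_filter, Set.mem_ofPred_eq] at hp hp'
        exact Prod.ext (hex p hp.1 p' hp'.1 hp.2 hp'.2) h
      calc _ = #(image Prod.snd ({p ∈ 𝒬 ×ˢ (univ : Finset Bool) | f p = K} : Finset _)) :=
            (card_image_of_injOn this).symm
        _ ≤ #(univ : Finset Bool) := card_le_univ _
        _ = 2 := by simp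
  have := card_le_mul_card_image_of_maps_to hmaps 2 hfib
  rw [card_product] at this
  simp at this
  omega

/-- The common neighbours in `R` of the vertices in `I`. -/
noncomputable def commonNbrs (G : SimpleGraph α) (R I : Finset α) : Finset α :=
  {y ∈ R | ∀ z ∈ I, G.Adj z y}

lemma card_fiber_le (I : Finset α) :
    #{T ∈ cliquesIn G (A ∪ R) k | T ∩ A = I} ≤ (#(commonNbrs G R I)).choose (k - #I) := by
  rw [← card_powersetCard]
  apply card_le_card_of_injOn (fun T => T \ A)
  · intro T hT
    simp only [coe_filter, Set.mem_ofPred_eq, mem_cliquesIn] at hT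
    obtain ⟨⟨⟨hT1, hT2⟩, hcl⟩, hI⟩ := hT
    refine mem_coe.2 (mem_powersetCard.2 ?_)
    refine ⟨fun y hy => ?_, ?_⟩
    · obtain ⟨hyT, hyA⟩ := mem_sdiff.1 hy
      refine mem_filter.2 ⟨(mem_union.1 (hT1 hyT)).resolve_left hyA, fun z hz => ?_⟩
      rw [← hI] at hz
      obtain ⟨hzT, hzA⟩ := mem_inter.1 hz
      exact hcl (mem_coe.2 hzT) (mem_coe.2 hyT) (fun h => hyA (h ▸ hzA))
    · change #(T \ A) = _
      have := card_sdiff_add_card_inter T A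
      rw [hI] at this
      omega
  · intro T hT T' hT' h
    simp only [coe_filter, Set.mem_ofPred_eq] at hT hT'
    simp only at h
    rw [← sdiff_union_inter T A, ← sdiff_union_inter T' A, h, hT.2, hT'.2]

lemma card_fiber_eq_zero (I : Finset α) (hI : G.IsClique (I : Set α) → k < #I) :
    #{T ∈ cliquesIn G (A ∪ R) k | T ∩ A = I} = 0 := by
  rw [card_eq_zero, filter_eq_empty_iff]
  rintro T hT rfl
  obtain ⟨⟨-, hT2⟩, hcl⟩ := mem_cliquesIn.1 hT
  have h1 := hI (hcl.subset (by simp))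
  have := card_le_card (inter_subset_left : T ∩ A ⊆ T)
  omega

lemma card_fiber_empty (hAR : Disjoint A R) :
    #{T ∈ cliquesIn G (A ∪ R) k | T ∩ A = ∅} = #(cliquesIn G R k) := by
  congr 1
  ext T
  simp only [mem_filter, mem_cliquesIn]
  constructor
  · rintro ⟨⟨⟨h1, h2⟩, h3⟩, h4⟩
    refine ⟨⟨fun y hy => (mem_union.1 (h1 hy)).resolve_left fun h => ?_, h2⟩, h3⟩
    have := mem_inter.2 ⟨hy, h⟩
    simp [h4] at this
  · rintro ⟨⟨h1, h2⟩, h3⟩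
    exact ⟨⟨⟨h1.trans subset_union_right, h2⟩, h3⟩,
      disjoint_iff_inter_eq_empty.1 (hAR.symm.mono_left h1)⟩

/-- Vandermonde's identity in the form in which one counts the `k`-subsets of a disjoint union
`A ∪ B`, where `#B = b`, by their intersection with `A`. -/
lemma sum_powerset_choose (A : Finset α) (b k : ℕ) :
    ∑ I ∈ A.powerset, (if #I ≤ k then b.choose (k - #I) else 0) = (#A + b).choose k := by
  rw [sum_powerset_apply_card (fun i => if i ≤ k then b.choose (k - i) else 0), Nat.add_choose_eq,
    Nat.sum_antidiagonal_eq_sum_range_succ_mk]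
  have h1 : ∀ n, k ≤ n → #A ≤ n →
      ∑ i ∈ range (#A + 1), (#A).choose i • (if i ≤ k then b.choose (k - i) else 0) =
      ∑ i ∈ range (n + 1), (#A).choose i • (if i ≤ k then b.choose (k - i) else 0) := by
    intro n _ hn
    apply sum_subset (range_subset_range.2 (by omega))
    intro i _ hi
    rw [Nat.choose_eq_zero_of_lt (by simp at hi; omega), zero_smul]
  have h2 : ∀ n, k ≤ n → ∑ i ∈ range (k + 1), (#A).choose i * b.choose (k - i) =
      ∑ i ∈ range (n + 1), (#A).choose i • (if i ≤ k then b.choose (k - i) else 0) := by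
    intro n hn
    rw [← sum_subset (range_subset_range.2 (by omega : k + 1 ≤ n + 1))]
    · refine sum_congr rfl fun i hi => ?_
      rw [if_pos (by simp at hi; omega), smul_eq_mul]
    · intro i _ hi
      rw [if_neg (by simp at hi; omega), smul_zero]
  rw [h1 (max k #A) (le_max_left _ _) (le_max_right _ _), h2 (max k #A) (le_max_left _ _)]

/-- The contribution of a set `I ⊆ A` to the count of the cliques in `A ∪ R` by their intersection
with `A`: it is at most the corresponding Vandermonde term. The terms `I` of size `m` and `m + 1` also
absorb the indicator that `I` is a clique, resp. a non-clique, with an error of one exactly for those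
`m`-cliques `I` that have the full number `b` of common neighbours in `R`. -/
lemma card_fiber_add_le (hm : 2 ≤ m) (hAR : Disjoint A R)
    (hR : #(cliquesIn G R (m + 1)) ≤ b.choose (m + 1))
    (hr : ∀ y ∈ A, #(commonNbrs G R {y}) ≤ b) {I : Finset α} (hI : I ⊆ A) :
    #{T ∈ cliquesIn G (A ∪ R) (m + 1) | T ∩ A = I} + (if I ∈ cliquesIn G A m then 1 else 0) +
        (if I ∈ A.powersetCard (m + 1) \ cliquesIn G A (m + 1) then 1 else 0) ≤
      (if #I ≤ m + 1 then b.choose (m + 1 - #I) else 0) +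
        (if I ∈ cliquesIn G A m ∧ #(commonNbrs G R I) = b then 1 else 0) := by
  rcases I.eq_empty_or_nonempty with rfl | ⟨y, hy⟩
  · have h1 : (∅ : Finset α) ∉ cliquesIn G A m := fun h => by
      have := (mem_cliquesIn.1 h).1.2
      simp at this; omega
    have h2 : (∅ : Finset α) ∉ A.powersetCard (m + 1) \ cliquesIn G A (m + 1) := fun h => by
      have := (mem_powersetCard.1 (mem_sdiff.1 h).1).2
      simp at this
    rw [card_fiber_empty hAR, if_neg h1, if_neg h2]
    simp
    omega
  · have hcb : #(commonNbrs G R I) ≤ b := by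
      refine le_trans (card_le_card fun w hw => ?_) (hr y (hI hy))
      obtain ⟨hw1, hw2⟩ := mem_filter.1 hw
      exact mem_filter.2 ⟨hw1, fun z hz => by rw [mem_singleton.1 hz]; exact hw2 y hy⟩
    have hc := card_fiber_le (G := G) (A := A) (R := R) (k := m + 1) I
    have hcc : (#(commonNbrs G R I)).choose (m + 1 - #I) ≤ b.choose (m + 1 - #I) :=
      Nat.choose_le_choose _ hcb
    have h0 := card_fiber_eq_zero (G := G) (A := A) (R := R) (k := m + 1) I
    by_cases hcard : #I = m
    · have h2 : I ∉ A.powersetCard (m + 1) \ cliquesIn G A (m + 1) := fun h => by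
        have := (mem_powersetCard.1 (mem_sdiff.1 h).1).2
        omega
      rw [if_neg h2, if_pos (show #I ≤ m + 1 by omega)]
      have h3 : m + 1 - #I = 1 := by omega
      rw [h3] at hc hcc ⊢
      simp only [Nat.choose_one_right] at hc hcc ⊢
      by_cases h4 : I ∈ cliquesIn G A m
      · by_cases h5 : #(commonNbrs G R I) = b
        · rw [if_pos h4, if_pos ⟨h4, h5⟩]
          omega
        · rw [if_pos h4, if_neg fun h => h5 h.2]
          omega
      · rw [if_neg h4, if_neg fun h => h4 h.1]
        omega
    · have h1 : I ∉ cliquesIn G A m := fun h => hcard (mem_cliquesIn.1 h).1.2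
      simp only [h1, false_and, if_false, add_zero]
      by_cases h2 : I ∈ A.powersetCard (m + 1) \ cliquesIn G A (m + 1)
      · obtain ⟨h3, h4⟩ := mem_sdiff.1 h2
        have h5 := (mem_powersetCard.1 h3).2
        rw [h0 fun hcl => absurd (mem_cliquesIn.2 ⟨mem_powersetCard.1 h3, hcl⟩) h4, if_pos h2,
          if_pos h5.le, h5]
        simp
      · rw [if_neg h2, add_zero]
        by_cases h3 : #I ≤ m + 1
        · rw [if_pos h3]
          exact hc.trans hcc
        · rw [h0 fun _ => by omega]
          exact Nat.zero_le _

/-- The counting step: the cliques with `m + 1` vertices of `A ∪ R`, together with the `m`-cliques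
of `A` (each completed by a vertex joined to all of `A`), number at most as many as the
`(m + 1)`-cliques of a complete graph on `#A + b` vertices. In the case of equality, every `m`-subset
of `A` is a clique with at least `b - 1` common neighbours in `R`. -/
lemma card_cliquesIn_union_add_le (hm : 2 ≤ m) (hAR : Disjoint A R) (hb : 1 ≤ b)
    (hR : #(cliquesIn G R (m + 1)) ≤ b.choose (m + 1))
    (hr : ∀ y ∈ A, #(commonNbrs G R {y}) ≤ b)
    (hne : ∀ y ∈ A, (commonNbrs G R {y}).Nonempty → ∃ u ∈ A, u ≠ y ∧ ¬ G.Adj y u) :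
    #(cliquesIn G (A ∪ R) (m + 1)) + #(cliquesIn G A m) ≤ (#A + b).choose (m + 1) ∧
    (#(cliquesIn G (A ∪ R) (m + 1)) + #(cliquesIn G A m) = (#A + b).choose (m + 1) →
      ∀ I ⊆ A, #I = m → G.IsClique (I : Set α) ∧ b ≤ #(commonNbrs G R I) + 1) := by
  have hpt := fun I (hI : I ∈ A.powerset) => card_fiber_add_le hm hAR hR hr (mem_powerset.1 hI)
  have hsum := sum_le_sum hpt
  have hcount : #(cliquesIn G (A ∪ R) (m + 1)) =
      ∑ I ∈ A.powerset, #{T ∈ cliquesIn G (A ∪ R) (m + 1) | T ∩ A = I} :=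
    card_eq_sum_card_fiberwise fun T _ => mem_coe.2 (mem_powerset.2 inter_subset_right)
  have hind : ∀ (p : Finset α → Prop) [DecidablePred p], (∀ I, p I → I ⊆ A) →
      ∀ 𝒮 : Finset (Finset α), (∀ I, I ∈ 𝒮 ↔ p I) →
      ∑ I ∈ A.powerset, (if p I then 1 else 0) = #𝒮 := by
    intro p _ hp 𝒮 h𝒮
    rw [← card_filter]
    congr 1
    ext I
    simp only [mem_filter, mem_powerset, h𝒮]
    exact ⟨fun h => h.2, fun h => ⟨hp I h, h⟩⟩
  have hQle : #{Q ∈ cliquesIn G A m | #(commonNbrs G R Q) = b} ≤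
      #(A.powersetCard (m + 1) \ cliquesIn G A (m + 1)) := by
    refine card_le_card_nonclique hm _ (filter_subset _ _) fun Q hQ q hq => ?_
    obtain ⟨hQ1, hQ2⟩ := mem_filter.1 hQ
    refine hne q ((mem_cliquesIn.1 hQ1).1.1 hq) ?_
    obtain ⟨w, hw⟩ := card_pos.1 (by omega : 0 < #(commonNbrs G R Q))
    obtain ⟨hw1, hw2⟩ := mem_filter.1 hw
    exact ⟨w, mem_filter.2 ⟨hw1, fun z hz => by rw [mem_singleton.1 hz]; exact hw2 q hq⟩⟩
  have e1 := hind (· ∈ cliquesIn G A m) (fun I h => (mem_cliquesIn.1 h).1.1) _ fun I => Iff.rfl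
  have e2 := hind (· ∈ A.powersetCard (m + 1) \ cliquesIn G A (m + 1))
    (fun I h => (mem_powersetCard.1 (mem_sdiff.1 h).1).1) _ fun I => Iff.rfl
  have e3 := hind (fun I => I ∈ cliquesIn G A m ∧ #(commonNbrs G R I) = b)
    (fun I h => (mem_cliquesIn.1 h.1).1.1) {Q ∈ cliquesIn G A m | #(commonNbrs G R Q) = b}
    fun I => by simp
  have e4 := sum_powerset_choose A b (m + 1)
  simp only [sum_add_distrib] at hsum
  rw [← hcount, e1, e2, e3, e4] at hsum
  refine ⟨by omega, fun heq I hI hIm => ?_⟩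
  have htight := (sum_eq_sum_iff_of_le hpt).1 (by
    simp only [sum_add_distrib]
    rw [← hcount, e1, e2, e3, e4]
    omega) I (mem_powerset.2 hI)
  have h2 : I ∉ A.powersetCard (m + 1) \ cliquesIn G A (m + 1) := fun h => by
    have := (mem_powersetCard.1 (mem_sdiff.1 h).1).2
    omega
  rw [if_neg h2, if_pos (show #I ≤ m + 1 by omega), show m + 1 - #I = 1 by omega,
    Nat.choose_one_right] at htight
  by_cases hcl : G.IsClique (I : Set α)
  · refine ⟨hcl, ?_⟩
    have hc := card_fiber_le (G := G) (A := A) (R := R) (k := m + 1) I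
    rw [show m + 1 - #I = 1 by omega, Nat.choose_one_right] at hc
    rw [if_pos (mem_cliquesIn.2 ⟨⟨hI, hIm⟩, hcl⟩)] at htight
    omega
  · have h1 : I ∉ cliquesIn G A m := fun h => hcl (mem_cliquesIn.1 h).2
    rw [card_fiber_eq_zero I fun h => absurd h hcl] at htight
    simp only [h1, false_and, if_false] at htight
    omega

lemma card_cliquesIn_eq {x : α} (hx : x ∈ V) :
    #(cliquesIn G V (m + 1)) =
      #(cliquesIn G (V.erase x) (m + 1)) + #(cliquesIn G {y ∈ V | G.Adj x y} m) := by
  rw [← card_filter_add_card_filter_not (s := cliquesIn G V (m + 1)) (fun T => x ∉ T)]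
  congr 1
  · congr 1
    ext T
    simp only [mem_filter, mem_cliquesIn, subset_erase]
    tauto
  · refine card_bij' (fun T _ => T.erase x) (fun T _ => insert x T) ?_ ?_ ?_ ?_
    · intro T hT
      simp only [mem_filter, mem_cliquesIn, not_not] at hT ⊢
      obtain ⟨⟨⟨h1, h2⟩, h3⟩, h4⟩ := hT
      refine ⟨⟨fun y hy => mem_filter.2 ⟨h1 (mem_of_mem_erase hy), ?_⟩, ?_⟩, ?_⟩
      · exact h3 (mem_coe.2 h4) (mem_coe.2 (mem_of_mem_erase hy)) (ne_of_mem_erase hy).symm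
      · rw [card_erase_of_mem h4, h2]; rfl
      · exact h3.subset (by simp)
    · intro T hT
      simp only [mem_filter, mem_cliquesIn, not_not] at hT ⊢
      obtain ⟨⟨h1, h2⟩, h3⟩ := hT
      have hxT : x ∉ T := fun h => G.loopless.irrefl x (mem_filter.1 (h1 h)).2
      refine ⟨⟨⟨insert_subset hx fun y hy => (mem_filter.1 (h1 hy)).1, ?_⟩, ?_⟩, mem_insert_self _ _⟩
      · rw [card_insert_of_notMem hxT, h2]
      · rw [coe_insert]
        exact h3.insert fun y hy _ => (mem_filter.1 (h1 hy)).2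
    · intro T hT
      exact insert_erase (not_not.1 (mem_filter.1 hT).2)
    · intro T hT
      exact erase_insert fun h =>
        G.loopless.irrefl x (mem_filter.1 ((mem_cliquesIn.1 hT).1.1 h)).2

/-- A graph without a star forest of more than `s` edges has at most as many cliques of a given
size `m + 1 ≥ 3` as the complete graph on `s + 1` vertices, and if `m ≤ s`, equality forces all
these cliques into a set of `s + 1` vertices. For `m = 1` and even `s > 0` the bound fails: remove a
perfect matching from the complete graph on `s + 2` vertices. -/
theorem StarForestBound.card_cliquesIn_le (hm : 2 ≤ m) (hV : StarForestBound G V s) :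
    #(cliquesIn G V (m + 1)) ≤ (s + 1).choose (m + 1) ∧
    (m ≤ s → #(cliquesIn G V (m + 1)) = (s + 1).choose (m + 1) →
      ∃ U ⊆ V, #U = s + 1 ∧ ∀ T ∈ cliquesIn G V (m + 1), T ⊆ U) := by
  induction hn : #V using Nat.strong_induction_on generalizing V s with
  | _ n ih =>
  rcases V.eq_empty_or_nonempty with rfl | hVne
  · have h0 : #(cliquesIn G (∅ : Finset α) (m + 1)) = 0 := by simp [cliquesIn]
    refine ⟨by omega, fun hms h => ?_⟩
    have := Nat.choose_pos (show m + 1 ≤ s + 1 by omega)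
    omega
  -- a vertex of maximum degree
  obtain ⟨x, hx, hmax⟩ := exists_max_image V (fun x => #{y ∈ V | G.Adj x y}) hVne
  have herase := card_cliquesIn_eq (G := G) (m := m) hx
  set A : Finset α := {y ∈ V | G.Adj x y} with hA
  set R : Finset α := {y ∈ V.erase x | ¬ G.Adj x y} with hRdef
  have hxA : x ∉ A := by simp [hA]
  have hxR : x ∉ R := by simp [hRdef]
  have hAV : A ⊆ V := filter_subset _ _
  have hRV : R ⊆ V := (filter_subset _ _).trans (erase_subset _ _)
  have hAR : Disjoint A R := by
    rw [disjoint_left]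
    intro y hy hy'
    exact (mem_filter.1 hy').2 (mem_filter.1 hy).2
  have hun : V.erase x = A ∪ R := by
    ext y
    simp only [hA, hRdef, mem_union, mem_filter, mem_erase]
    constructor
    · tauto
    · rintro (⟨h1, h2⟩ | h)
      · exact ⟨h2.ne', h1⟩
      · exact h.1
  have hAs : #A ≤ s := by
    refine hV A hAV fun y hy => ⟨x, by simp [hx, hxA], ?_⟩
    exact (mem_filter.1 hy).2.symm
  obtain ⟨b, hb⟩ : ∃ b, #A + b = s + 1 := ⟨s + 1 - #A, by omega⟩
  have hRbound : StarForestBound G R (s - #A) := by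
    intro B hB hBd
    have hAB : Disjoint A B := hAR.mono_right hB
    have := hV (A ∪ B) (union_subset hAV (hB.trans hRV)) fun y hy => ?_
    · rw [card_union_of_disjoint hAB] at this
      omega
    · rcases mem_union.1 hy with hy | hy
      · refine ⟨x, ?_, (mem_filter.1 hy).2.symm⟩
        simp only [mem_sdiff, mem_union, hx, hxA, true_and, false_or]
        exact fun h => hxR (hB h)
      · obtain ⟨d, hd, hadj⟩ := hBd y hy
        obtain ⟨hd1, hd2⟩ := mem_sdiff.1 hd
        refine ⟨d, ?_, hadj⟩
        simp only [mem_sdiff, mem_union, hRV hd1, hd2, true_and, or_false]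
        exact fun h => disjoint_left.1 hAR h hd1
  have hRcard : #R < n := by
    rw [← hn]
    exact card_lt_card ⟨hRV, fun h => hxR (h hx)⟩
  have hRle := (ih #R hRcard hRbound rfl).1
  rw [show s - #A + 1 = b by omega] at hRle
  have hr : ∀ y ∈ A, #(commonNbrs G R {y}) ≤ b := by
    intro y hy
    have hyR : commonNbrs G R {y} ⊆ R := filter_subset _ _
    have hdis : Disjoint (A.erase y) (commonNbrs G R {y}) :=
      hAR.mono (erase_subset _ _) hyR
    -- the star forest with centres `x` and `y`
    have := hV (A.erase y ∪ commonNbrs G R {y})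
      (union_subset ((erase_subset _ _).trans hAV) (hyR.trans hRV)) fun z hz => ?_
    · rw [card_union_of_disjoint hdis, card_erase_of_mem hy] at this
      have : 0 < #A := card_pos.2 ⟨y, hy⟩
      omega
    · rcases mem_union.1 hz with hz | hz
      · refine ⟨x, ?_, (mem_filter.1 (mem_of_mem_erase hz)).2.symm⟩
        simp only [mem_sdiff, mem_union, hx, true_and, not_or]
        exact ⟨fun h => hxA (mem_of_mem_erase h), fun h => hxR (hyR h)⟩
      · refine ⟨y, ?_, ((mem_filter.1 hz).2 y (mem_singleton_self y)).symm⟩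
        simp only [mem_sdiff, mem_union, hAV hy, true_and, not_or]
        exact ⟨fun h => ne_of_mem_erase h rfl, fun h => disjoint_left.1 hAR hy (hyR h)⟩
  have hne : ∀ y ∈ A, (commonNbrs G R {y}).Nonempty → ∃ u ∈ A, u ≠ y ∧ ¬ G.Adj y u := by
    rintro y hy ⟨w, hw⟩
    by_contra! hcon
    -- otherwise the degree of `y` would exceed that of `x`
    have hdeg := hmax y (hAV hy)
    obtain ⟨hw1, hw2⟩ := mem_filter.1 hw
    have hsub : insert x (insert w (A.erase y)) ⊆ {z ∈ V | G.Adj y z} := by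
      intro z hz
      rcases mem_insert.1 hz with rfl | hz
      · exact mem_filter.2 ⟨hx, (mem_filter.1 hy).2.symm⟩
      rcases mem_insert.1 hz with rfl | hz
      · exact mem_filter.2 ⟨hRV hw1, hw2 y (mem_singleton_self y)⟩
      · exact mem_filter.2 ⟨hAV (mem_of_mem_erase hz),
          hcon z (mem_of_mem_erase hz) (ne_of_mem_erase hz)⟩
    have h1 := card_le_card hsub
    rw [card_insert_of_notMem, card_insert_of_notMem, card_erase_of_mem hy] at h1
    · have : 0 < #A := card_pos.2 ⟨y, hy⟩
      omega
    · exact fun h => disjoint_left.1 hAR (mem_of_mem_erase h) hw1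
    · simp only [mem_insert, not_or]
      exact ⟨fun h => hxR (h ▸ hw1), fun h => hxA (mem_of_mem_erase h)⟩
  obtain ⟨hle, htight⟩ := card_cliquesIn_union_add_le hm hAR (by omega) hRle hr hne
  rw [← hun, ← herase, hb] at hle htight
  refine ⟨hle, fun hms heq => ?_⟩
  replace htight := htight heq
  have hpos := Nat.choose_pos (show m + 1 ≤ s + 1 by omega)
  have hmA : m ≤ #A := by
    by_contra! hlt
    have : cliquesIn G V (m + 1) = ∅ := by
      rw [eq_empty_iff_forall_notMem]
      intro T hT
      obtain ⟨⟨h1, h2⟩, h3⟩ := mem_cliquesIn.1 hT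
      obtain ⟨y, hy⟩ := card_pos.1 (by omega : 0 < #T)
      have hdeg := hmax y (h1 hy)
      have hsub : T.erase y ⊆ {z ∈ V | G.Adj y z} := fun z hz =>
        mem_filter.2 ⟨h1 (mem_of_mem_erase hz),
          h3 (mem_coe.2 hy) (mem_coe.2 (mem_of_mem_erase hz)) (ne_of_mem_erase hz).symm⟩
      have := card_le_card hsub
      rw [card_erase_of_mem hy] at this
      omega
    rw [this, card_empty] at heq
    omega
  have hAcl : ∀ y ∈ A, ∀ z ∈ A, z ≠ y → G.Adj y z := by
    intro y hy z hz hzy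
    obtain ⟨I, hI1, hI2, hI3⟩ := exists_subsuperset_card_eq
      (insert_subset hy (singleton_subset_iff.2 hz)) (card_le_two.trans hm) hmA
    refine (htight I hI2 hI3).1 (mem_coe.2 (hI1 ?_)) (mem_coe.2 (hI1 ?_)) hzy.symm <;> simp
  have hnoR : ∀ y ∈ A, commonNbrs G R {y} = ∅ := by
    intro y hy
    by_contra h
    obtain ⟨u, hu, huy, hnadj⟩ := hne y hy (nonempty_iff_ne_empty.2 h)
    exact hnadj (hAcl y hy u hu huy)
  have hbA : b = 1 := by
    obtain ⟨I, hI1, hI2⟩ := exists_subset_card_eq hmA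
    have h1 := (htight I hI1 hI2).2
    obtain ⟨y, hy⟩ := card_pos.1 (by omega : 0 < #I)
    have h2 : commonNbrs G R I ⊆ commonNbrs G R {y} := fun w hw =>
      mem_filter.2 ⟨(mem_filter.1 hw).1, fun z hz => by
        rw [mem_singleton.1 hz]; exact (mem_filter.1 hw).2 y hy⟩
    rw [hnoR y (hI1 hy), subset_empty] at h2
    rw [h2, card_empty] at h1
    omega
  refine ⟨insert x A, insert_subset hx hAV, ?_, fun T hT => ?_⟩
  · rw [card_insert_of_notMem hxA]
    omega
  · obtain ⟨⟨h1, h2⟩, h3⟩ := mem_cliquesIn.1 hT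
    by_contra hcon
    obtain ⟨w, hwT, hw⟩ := not_subset.1 hcon
    have hmemR : ∀ w ∈ T, w ∉ insert x A → w ∈ R := by
      intro w hwT hw
      have : w ∈ A ∪ R := hun ▸ mem_erase.2 ⟨fun h => hw (h ▸ mem_insert_self _ _), h1 hwT⟩
      exact (mem_union.1 this).resolve_left fun h => hw (mem_insert_of_mem h)
    have hwR := hmemR w hwT hw
    obtain ⟨z, hzT, hzw⟩ := exists_mem_ne (by omega : 1 < #T) w
    have hadj : G.Adj z w := h3 (mem_coe.2 hzT) (mem_coe.2 hwT) hzw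
    by_cases hz : z ∈ insert x A
    · rcases mem_insert.1 hz with rfl | hz
      · exact (mem_filter.1 hwR).2 hadj
      · have : w ∈ commonNbrs G R {z} :=
          mem_filter.2 ⟨hwR, fun y hy => by rw [mem_singleton.1 hy]; exact hadj⟩
        simp [hnoR z hz] at this
    · -- an edge inside `R` would contradict the star forest bound for `R`
      have := hRbound {z} (singleton_subset_iff.2 (hmemR z hzT hz)) fun y hy => ?_
      · rw [card_singleton] at this
        omega
      · rw [mem_singleton.1 hy]
        exact ⟨w, by simp [hwR, hzw.symm], hadj⟩

end Graph

/-! ### The sunflower lemma -/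

section Sunflower

variable {α : Type*}

/-- Sunflower lemma, by induction on the number `j` of vertices not yet fixed: if no sunflower
in `𝓕` (with nonempty petals) has more than `m` petals, then at most `(t * m) ^ j` members of `𝓕`
contain a given set `A` of `t - j` vertices. -/
lemma card_filter_superset_le_of_sunflower_le {t m : ℕ} {𝓕 : Finset (Finset α)}
    (h𝓕 : ∀ T ∈ 𝓕, #T = t)
    (hsun : ∀ A, ∀ 𝒮 ⊆ 𝓕, (∀ T ∈ 𝒮, A ⊂ T) → (∀ T ∈ 𝒮, ∀ T' ∈ 𝒮, T ≠ T' → T ∩ T' = A) → #𝒮 ≤ m)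
    (j : ℕ) (A : Finset α) (hA : #A + j = t) : #{T ∈ 𝓕 | A ⊆ T} ≤ (t * m) ^ j := by
  induction j generalizing A with
  | zero =>
    rw [pow_zero, card_le_one]
    have : ∀ T ∈ ({T ∈ 𝓕 | A ⊆ T} : Finset _), A = T := by
      intro T hT
      obtain ⟨h1, h2⟩ := mem_filter.1 hT
      exact eq_of_subset_of_card_le h2 (by rw [h𝓕 T h1]; omega)
    intro T hT T' hT'
    rw [← this T hT, ← this T' hT']
  | succ j ih =>
    -- a largest sunflower with kernel `A`
    obtain ⟨𝒮, h𝒮, hmax⟩ := exists_max_image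
      ({𝒮 ∈ 𝓕.powerset | (∀ T ∈ 𝒮, A ⊂ T) ∧ ∀ T ∈ 𝒮, ∀ T' ∈ 𝒮, T ≠ T' → T ∩ T' = A} :
        Finset (Finset (Finset α))) card ⟨∅, by simp⟩
    obtain ⟨h𝒮1, h𝒮2, h𝒮3⟩ := mem_filter.1 h𝒮
    rw [mem_powerset] at h𝒮1
    have hY : #(𝒮.biUnion (· \ A)) ≤ t * m := by
      refine (card_biUnion_le_card_mul _ _ t fun T hT => ?_).trans ?_
      · exact (card_le_card sdiff_subset).trans (h𝓕 T (h𝒮1 hT)).le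
      · rw [mul_comm]
        exact Nat.mul_le_mul_left _ (hsun A 𝒮 h𝒮1 h𝒮2 h𝒮3)
    have hcover : ({T ∈ 𝓕 | A ⊆ T} : Finset _) ⊆
        (𝒮.biUnion (· \ A)).biUnion fun y => {T ∈ 𝓕 | insert y A ⊆ T} := by
      intro T hT
      obtain ⟨hT1, hT2⟩ := mem_filter.1 hT
      have hAT : A ⊂ T := ⟨hT2, fun h => by
        have := card_le_card h
        rw [h𝓕 T hT1] at this
        omega⟩
      by_contra hcon
      have hno : ∀ y ∈ T, y ∉ A → ∀ T' ∈ 𝒮, y ∉ T' := by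
        intro y hy hyA T' hT' hyT'
        exact hcon (mem_biUnion.2 ⟨y, mem_biUnion.2 ⟨T', hT', mem_sdiff.2 ⟨hyT', hyA⟩⟩,
          mem_filter.2 ⟨hT1, insert_subset hy hT2⟩⟩)
      have hint : ∀ T' ∈ 𝒮, T ∩ T' = A := by
        intro T' hT'
        refine subset_antisymm (fun y hy => ?_) (subset_inter hT2 (h𝒮2 T' hT').1)
        by_contra hyA
        exact hno y (mem_inter.1 hy).1 hyA T' hT' (mem_inter.1 hy).2
      have hT𝒮 : T ∉ 𝒮 := fun h => by
        have := hint T h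
        rw [inter_self] at this
        exact hAT.ne this.symm
      have := hmax (insert T 𝒮) (mem_filter.2 ⟨mem_powerset.2 (insert_subset hT1 h𝒮1), ?_, ?_⟩)
      · rw [card_insert_of_notMem hT𝒮] at this
        omega
      · intro T' hT'
        rcases mem_insert.1 hT' with rfl | hT'
        · exact hAT
        · exact h𝒮2 T' hT'
      · intro T₁ h₁ T₂ h₂ hne
        rcases mem_insert.1 h₁ with rfl | h₃ <;> rcases mem_insert.1 h₂ with rfl | h₄
        · exact absurd rfl hne
        · exact hint T₂ h₄
        · rw [inter_comm]
          exact hint T₁ h₃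
        · exact h𝒮3 T₁ h₃ T₂ h₄ hne
    calc _ ≤ _ := card_le_card hcover
      _ ≤ #(𝒮.biUnion (· \ A)) * (t * m) ^ j := by
        refine card_biUnion_le_card_mul _ _ _ fun y hy => ih (insert y A) ?_
        obtain ⟨T, hT, hyT⟩ := mem_biUnion.1 hy
        rw [card_insert_of_notMem (mem_sdiff.1 hyT).2]
        omega
      _ ≤ (t * m) * (t * m) ^ j := Nat.mul_le_mul_right _ hY
      _ = (t * m) ^ (j + 1) := by ring

end Sunflower

/-! ### Sets with at most one element outside a given set -/

section Counting

variable {α : Type*}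

/-- The number of `(k + 1)`-subsets of `V` with at most one element outside `U`. -/
lemma card_filter_card_sdiff_le_one {U V : Finset α} (hUV : U ⊆ V) (k : ℕ) :
    #{T ∈ V.powersetCard (k + 1) | #(T \ U) ≤ 1} =
      (#U).choose k * (#V - #U) + (#U).choose (k + 1) := by
  have hset : ({T ∈ V.powersetCard (k + 1) | #(T \ U) ≤ 1} : Finset _) =
      ((U.powersetCard k ×ˢ (V \ U)).image fun p => insert p.2 p.1) ∪
        U.powersetCard (k + 1) := by
    ext T
    simp only [mem_filter, mem_union, mem_image, mem_product, mem_powersetCard, mem_sdiff,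
      Prod.exists]
    constructor
    · rintro ⟨⟨h1, h2⟩, h3⟩
      rcases Nat.le_one_iff_eq_zero_or_eq_one.1 h3 with h | h
      · exact Or.inr ⟨sdiff_eq_empty_iff_subset.1 (card_eq_zero.1 h), h2⟩
      · obtain ⟨v, hv⟩ := card_eq_one.1 h
        have hvT : v ∈ T \ U := hv ▸ mem_singleton_self v
        obtain ⟨hvT, hvU⟩ := mem_sdiff.1 hvT
        refine Or.inl ⟨T.erase v, v, ⟨⟨fun y hy => ?_, ?_⟩, h1 hvT, hvU⟩, insert_erase hvT⟩
        · by_contra hyU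
          have : y ∈ T \ U := mem_sdiff.2 ⟨mem_of_mem_erase hy, hyU⟩
          rw [hv, mem_singleton] at this
          exact ne_of_mem_erase hy this
        · rw [card_erase_of_mem hvT, h2]
          rfl
    · rintro (⟨A, v, ⟨⟨h1, h2⟩, h3, h4⟩, rfl⟩ | ⟨h1, h2⟩)
      · refine ⟨⟨insert_subset h3 (h1.trans hUV), ?_⟩, ?_⟩
        · rw [card_insert_of_notMem fun h => h4 (h1 h), h2]
        · rw [insert_sdiff_of_notMem _ h4, sdiff_eq_empty_iff_subset.2 h1]
          simp
      · refine ⟨⟨h1.trans hUV, h2⟩, ?_⟩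
        rw [sdiff_eq_empty_iff_subset.2 h1]
        simp
  rw [hset, card_union_of_disjoint, card_image_of_injOn, card_product, card_powersetCard,
    card_powersetCard, card_sdiff_of_subset hUV]
  · rintro ⟨A, v⟩ hp ⟨A', v'⟩ hp' h
    simp only [coe_product, Set.mem_prod, mem_coe, mem_powersetCard, mem_sdiff] at hp hp' h
    have hA : A = A' := by
      have h1 : insert v A ∩ U = A := by
        rw [insert_inter_of_notMem hp.2.2, inter_eq_left.2 hp.1.1]
      have h2 : insert v' A' ∩ U = A' := by
        rw [insert_inter_of_notMem hp'.2.2, inter_eq_left.2 hp'.1.1]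
      rw [← h1, h, h2]
    subst hA
    have : v ∈ insert v' A := h ▸ mem_insert_self v A
    rcases mem_insert.1 this with rfl | hv
    · rfl
    · exact absurd (hp.1.1 hv) hp.2.2
  · rw [disjoint_left]
    intro T hT hT'
    obtain ⟨p, hp, rfl⟩ := mem_image.1 hT
    exact (mem_sdiff.1 (mem_product.1 hp).2).2
      ((mem_powersetCard.1 hT').1 (mem_insert_self _ _))

end Counting

/-! ### Copies of complete hypergraphs -/

section Copies

variable {α β : Type*}

lemma image_completeUniformOn {U : Set β} {f : β → α} (hf : Set.InjOn f U) (r : ℕ) :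
    (completeUniformOn U r).image f = completeUniformOn (f '' U) r := by
  ext e
  · rfl
  · simp only [Hypergraph.image_edgeSet, completeUniformOn, Set.mem_image, Set.mem_ofPred_eq]
    constructor
    · rintro ⟨e, ⟨h1, h2⟩, rfl⟩
      exact ⟨Set.image_mono h1, by rw [(hf.mono h1).encard_image, h2]⟩
    · rintro ⟨h1, h2⟩
      obtain ⟨e', he', rfl⟩ := Set.subset_image_iff.1 h1
      exact ⟨e', ⟨he', by rw [← h2, (hf.mono he').encard_image]⟩, rfl⟩

/-- The `t`-subsets of `V` all of whose triples are hyperedges of `H`. When `V` is the vertex set of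
`H`, these are the vertex sets of the copies of `𝒦_t^3` in `H`. -/
noncomputable def tripleCliques (H : Hypergraph α) (V : Finset α) (t : ℕ) : Finset (Finset α) :=
  {T ∈ V.powersetCard t | ∀ e ⊆ T, #e = 3 → (e : Set α) ∈ H.edgeSet}

lemma mem_tripleCliques {H : Hypergraph α} {V : Finset α} {t : ℕ} {T : Finset α} :
    T ∈ tripleCliques H V t ↔
      (T ⊆ V ∧ #T = t) ∧ ∀ e ⊆ T, #e = 3 → (e : Set α) ∈ H.edgeSet := by
  simp [tripleCliques]

lemma numCopies_completeUniform {H : Hypergraph α} {V : Finset α} (hV : H.vertexSet = V) (t : ℕ) :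
    numCopies (completeUniform t 3) H = #(tripleCliques H V t) := by
  have : copies (completeUniform t 3) H =
      (fun T : Finset α => completeUniformOn (T : Set α) 3) '' (tripleCliques H V t) := by
    ext K
    simp only [copies, Set.mem_ofPred_eq, Set.mem_image, mem_coe, mem_tripleCliques]
    constructor
    · rintro ⟨⟨h1, h2⟩, f, hf, rfl⟩
      have hf' : Function.Injective f := Set.injOn_univ.1 hf
      have himg : (completeUniform t 3).image f =
          completeUniformOn ((univ.image f : Finset α) : Set α) 3 := by
        rw [completeUniform, image_completeUniformOn hf'.injOn]
        simp
      rw [himg] at h1 h2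
      refine ⟨univ.image f, ⟨⟨?_, ?_⟩, fun e he hc => h2 ⟨?_, ?_⟩⟩, himg.symm⟩
      · rw [hV] at h1
        exact_mod_cast h1
      · rw [card_image_of_injective _ hf']
        simp
      · exact_mod_cast he
      · rw [Set.encard_coe_eq_coe_finsetCard, hc]
    · rintro ⟨T, ⟨⟨h1, h2⟩, h3⟩, rfl⟩
      have hinj : Function.Injective fun i => ((T.equivFinOfCardEq h2).symm i : α) :=
        Subtype.val_injective.comp (Equiv.injective _)
      refine ⟨⟨?_, ?_⟩, fun i => (T.equivFinOfCardEq h2).symm i, hinj.injOn, ?_⟩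
      · rw [hV]
        exact_mod_cast h1
      · rintro e ⟨he1, he2⟩
        have hfin : e.Finite := T.finite_toSet.subset he1
        lift e to Finset α using hfin
        rw [Set.encard_coe_eq_coe_finsetCard] at he2
        exact h3 e (by exact_mod_cast he1) (by exact_mod_cast he2)
      · rw [completeUniform, image_completeUniformOn hinj.injOn]
        congr 1
        rw [Set.image_univ]
        ext y
        simp only [Set.mem_range, mem_coe]
        constructor
        · intro hy
          exact ⟨T.equivFinOfCardEq h2 ⟨y, hy⟩, by simp⟩
        · rintro ⟨i, rfl⟩
          exact Subtype.property _
  rw [numCopies, this, Set.ncard_image_of_injective, Set.ncard_coe_finset]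
  intro T T' h
  exact coe_injective (congrArg Hypergraph.vertexSet h)

end Copies

/-! ### Matchings in traces -/

section Trace

variable {α : Type*} {H : Hypergraph α} {V : Finset α} {s t : ℕ}

/-- The pairs `{y i, z i}` form a matching in the trace of `H` on their union, since the third
vertices `w i` of the hyperedges `{y i, z i, w i}` lie outside it. -/
lemma containsAsTrace_matching_of_triples {ι : Type*} [Fintype ι] (hι : Fintype.card ι = s + 1)
    (y z w : ι → α) (hy : Function.Injective y) (hz : Function.Injective z)
    (hyz : ∀ i j, y i ≠ z j) (hwy : ∀ i j, w i ≠ y j) (hwz : ∀ i j, w i ≠ z j)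
    (he : ∀ i, ({y i, z i, w i} : Set α) ∈ H.edgeSet) :
    ContainsAsTrace H (matching (s + 1)) := by
  let φ : Fin (s + 1) ≃ ι := (Fintype.equivFinOfCardEq hι).symm
  set f : Fin (s + 1) × Fin 2 → α := fun p => if p.2 = 0 then y (φ p.1) else z (φ p.1) with hf
  have hf0 : ∀ i, f (i, 0) = y (φ i) := fun i => by simp [hf]
  have hf1 : ∀ i, f (i, 1) = z (φ i) := fun i => by simp [hf]
  have hinj : Function.Injective f := by
    rintro ⟨i, a⟩ ⟨j, c⟩ h
    fin_cases a <;> fin_cases c <;> simp only [Fin.zero_eta, Fin.mk_one, hf0, hf1] at h ⊢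
    · rw [φ.injective (hy h)]
    · exact absurd h (hyz _ _)
    · exact absurd h.symm (hyz _ _)
    · rw [φ.injective (hz h)]
  refine ⟨Set.range f, ?_, ?_, (matching (s + 1)).image f, ⟨?_, ?_⟩, f, hinj.injOn, rfl⟩
  · rintro _ ⟨⟨i, a⟩, rfl⟩
    refine H.subset_vertexSet_of_mem_edgeSet' (he (φ i)) ?_
    fin_cases a <;> simp [hf0, hf1]
  · rw [← Set.image_univ, hinj.injOn.encard_image]
    rfl
  · rintro _ ⟨p, -, rfl⟩
    exact ⟨p, rfl⟩
  · rintro _ ⟨_, ⟨i, rfl⟩, rfl⟩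
    refine ⟨_, he (φ i), ?_⟩
    rw [Set.image_pair, hf0, hf1]
    ext v
    simp only [Set.mem_insert_iff, Set.mem_singleton_iff, Set.mem_inter_iff, Set.mem_range]
    constructor
    · rintro (rfl | rfl)
      · exact ⟨Or.inl rfl, (i, 0), hf0 i⟩
      · exact ⟨Or.inr (Or.inl rfl), (i, 1), hf1 i⟩
    · rintro ⟨rfl | rfl | rfl, ⟨j, c⟩, hp⟩
      · exact Or.inl rfl
      · exact Or.inr rfl
      · exfalso
        fin_cases c <;> simp only [Fin.zero_eta, Fin.mk_one, hf0, hf1] at hp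
        · exact hwy _ _ hp.symm
        · exact hwz _ _ hp.symm

lemma mem_edgeSet_of_mem_tripleCliques {T : Finset α} (hT : T ∈ tripleCliques H V t) {x y z : α}
    (hx : x ∈ T) (hy : y ∈ T) (hz : z ∈ T) (hxy : x ≠ y) (hxz : x ≠ z) (hyz : y ≠ z) :
    ({x, y, z} : Set α) ∈ H.edgeSet := by
  have := (mem_tripleCliques.1 hT).2 {x, y, z} (by simp [insert_subset_iff, *])
    (card_eq_three.2 ⟨x, y, z, hxy, hxz, hyz, rfl⟩)
  simpa using this

/-- A sunflower of cliques whose petals have at least two vertices contains one pair from each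
petal; a third vertex of the clique completes the pair to a hyperedge. -/
lemma card_sunflower_le (hH : ¬ ContainsAsTrace H (matching (s + 1))) (ht : 3 ≤ t) {A : Finset α}
    (hA : #A + 2 ≤ t) {𝒮 : Finset (Finset α)} (h𝒮 : 𝒮 ⊆ tripleCliques H V t)
    (hpair : ∀ T ∈ 𝒮, ∀ T' ∈ 𝒮, T ≠ T' → T ∩ T' = A) : #𝒮 ≤ s := by
  by_contra! hlt
  obtain ⟨𝒮', h𝒮', hcard⟩ := exists_subset_card_eq (Nat.succ_le_of_lt hlt)
  have hsel : ∀ T : 𝒮', ∃ y z w, y ∈ T.1 \ A ∧ z ∈ T.1 \ A ∧ w ∈ T.1 ∧ y ≠ z ∧ w ≠ y ∧ w ≠ z := by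
    rintro ⟨T, hT⟩
    have hTt := (mem_tripleCliques.1 (h𝒮 (h𝒮' hT))).1.2
    have h1 : 1 < #(T \ A) := by
      have := le_card_sdiff A T
      omega
    obtain ⟨y, hy, z, hz, hyz⟩ := one_lt_card.1 h1
    have h2 : ∃ w ∈ T, w ∉ ({y, z} : Finset α) :=
      exists_mem_notMem_of_card_lt_card (by rw [card_pair hyz, hTt]; omega)
    obtain ⟨w, hw, hw'⟩ := h2
    simp only [mem_insert, mem_singleton, not_or] at hw'
    exact ⟨y, z, w, hy, hz, hw, hyz, hw'.1, hw'.2⟩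
  choose y z w hy hz hw hyz hwy hwz using hsel
  have hsame : ∀ (T T' : 𝒮') (v : α), v ∈ T.1 → v ∈ T'.1 \ A → T = T' := by
    intro T T' v hv hv'
    by_contra hne
    have := hpair T (h𝒮' T.2) T' (h𝒮' T'.2) fun h => hne (Subtype.ext h)
    obtain ⟨h1, h2⟩ := mem_sdiff.1 hv'
    exact h2 (this ▸ mem_inter.2 ⟨hv, h1⟩)
  refine hH (containsAsTrace_matching_of_triples (ι := 𝒮') (by simpa using hcard) y z w
    ?_ ?_ ?_ ?_ ?_ ?_)
  · exact fun T T' h => hsame T T' (y T) (mem_sdiff.1 (hy T)).1 (h ▸ hy T')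
  · exact fun T T' h => hsame T T' (z T) (mem_sdiff.1 (hz T)).1 (h ▸ hz T')
  · intro T T' h
    obtain rfl := hsame T T' (y T) (mem_sdiff.1 (hy T)).1 (h ▸ hz T')
    exact hyz T h
  · intro T T' h
    obtain rfl := hsame T T' (w T) (hw T) (h ▸ hy T')
    exact hwy T h
  · intro T T' h
    obtain rfl := hsame T T' (w T) (hw T) (h ▸ hz T')
    exact hwz T h
  · exact fun T => mem_edgeSet_of_mem_tripleCliques (h𝒮 (h𝒮' T.2)) (mem_sdiff.1 (hy T)).1
      (mem_sdiff.1 (hz T)).1 (hw T) (hyz T) (hwy T).symm (hwz T).symm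

end Trace

/-! ### Heavy sets -/

section Heavy

variable {α : Type*} {H : Hypergraph α} {V : Finset α} {s k M : ℕ}

/-- The vertices that extend `A` to a clique with `k + 1` vertices. -/
noncomputable def cliqueExtensions (H : Hypergraph α) (V : Finset α) (k : ℕ) (A : Finset α) :
    Finset α :=
  {v ∈ V | v ∉ A ∧ insert v A ∈ tripleCliques H V (k + 1)}

/-- The `k`-subsets of `V` with at least `M` extensions to a clique with `k + 1` vertices. -/
noncomputable def heavySets (H : Hypergraph α) (V : Finset α) (k M : ℕ) : Finset (Finset α) :=
  {A ∈ V.powersetCard k | M ≤ #(cliqueExtensions H V k A)}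

/-- The graph joining two vertices that lie in a common heavy set. -/
def heavyGraph (H : Hypergraph α) (V : Finset α) (k M : ℕ) : SimpleGraph α where
  Adj u v := u ≠ v ∧ ∃ A ∈ heavySets H V k M, u ∈ A ∧ v ∈ A
  symm := ⟨fun _ _ h => ⟨h.1.symm, h.2.imp fun _ h => ⟨h.1, h.2.2, h.2.1⟩⟩⟩
  loopless := ⟨fun _ h => h.1 rfl⟩

lemma heavySets_subset_cliquesIn : heavySets H V k M ⊆ cliquesIn (heavyGraph H V k M) V k := by
  intro A hA
  exact mem_cliquesIn.2 ⟨mem_powersetCard.1 (mem_filter.1 hA).1,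
    fun u hu v hv huv => ⟨huv, A, hA, mem_coe.1 hu, mem_coe.1 hv⟩⟩

/-- Few heavy sets can be extended simultaneously by distinct vertices avoiding a small set. -/
lemma exists_injective_extension {ι : Type*} [Fintype ι] {A : ι → Finset α}
    (hA : ∀ i, A i ∈ heavySets H V k M) {X : Finset α} (hM : Fintype.card ι + #X ≤ M) :
    ∃ v : ι → α, Function.Injective v ∧
      ∀ i, v i ∉ X ∧ v i ∉ A i ∧ insert (v i) (A i) ∈ tripleCliques H V (k + 1) := by
  obtain ⟨v, hv, hv'⟩ := (all_card_le_biUnion_card_iff_exists_injective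
    fun i => cliqueExtensions H V k (A i) \ X).1 fun J => by
      rcases J.eq_empty_or_nonempty with rfl | ⟨i, hi⟩
      · simp
      · have h1 : #J ≤ Fintype.card ι := card_le_univ J
        have h2 := (mem_filter.1 (hA i)).2
        have h3 := le_card_sdiff X (cliqueExtensions H V k (A i))
        have h4 := card_le_card (subset_biUnion_of_mem
          (fun i => cliqueExtensions H V k (A i) \ X) hi)
        omega
  refine ⟨v, hv, fun i => ?_⟩
  obtain ⟨h1, h2⟩ := mem_sdiff.1 (hv' i)
  exact ⟨h2, (mem_filter.1 h1).2⟩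

/-- A star forest in the heavy graph with leaves `b` and centres `d b` yields a matching in a
trace: match each leaf `b` with a new vertex extending a heavy set that contains `b` and `d b`. -/
lemma starForestBound_heavyGraph (hH : ¬ ContainsAsTrace H (matching (s + 1)))
    (hM : 3 * (s + 1) ≤ M) : StarForestBound (heavyGraph H V k M) V s := by
  intro B _ hBd
  by_contra! hlt
  obtain ⟨B', hB', hcard⟩ := exists_subset_card_eq (Nat.succ_le_of_lt hlt)
  have hsel : ∀ b : B', ∃ d A, d ∉ B' ∧ A ∈ heavySets H V k M ∧ b.1 ∈ A ∧ d ∈ A := by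
    intro b
    obtain ⟨d, hd, -, A, hA, h1, h2⟩ := hBd b (hB' b.2)
    exact ⟨d, A, fun h => (mem_sdiff.1 hd).2 (hB' h), hA, h1, h2⟩
  choose d A hd hA hbA hdA using hsel
  have hX : #(B' ∪ univ.image d) ≤ 2 * (s + 1) := by
    have h1 := card_union_le B' (univ.image d)
    have h2 : #(univ.image d) ≤ #(univ : Finset B') := card_image_le
    rw [card_univ, Fintype.card_coe] at h2
    omega
  obtain ⟨v, hv, hv'⟩ := exists_injective_extension hA (X := B' ∪ univ.image d) (by
    rw [Fintype.card_coe]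
    omega)
  have hvB : ∀ i, v i ∉ B' := fun i h => (hv' i).1 (mem_union_left _ h)
  have hvd : ∀ i j, v i ≠ d j := fun i j h =>
    (hv' i).1 (mem_union_right _ (mem_image.2 ⟨j, mem_univ j, h.symm⟩))
  have hbd : ∀ i j : B', d i ≠ j := fun i j h => hd i (h ▸ j.2)
  refine hH (containsAsTrace_matching_of_triples (ι := B') (by simpa using hcard)
    Subtype.val v d Subtype.val_injective hv ?_ hbd ?_ fun i => ?_)
  · exact fun i j h => hvB j (h ▸ i.2)
  · exact fun i j h => hvd j i h.symm
  · exact mem_edgeSet_of_mem_tripleCliques (hv' i).2.2 (mem_insert_of_mem (hbA i))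
      (mem_insert_self _ _) (mem_insert_of_mem (hdA i)) (fun h => hvB i (h ▸ i.2))
      (hbd i i).symm (hvd i i)

/-- By the sunflower lemma, the cliques that contain no heavy set are bounded in number. -/
lemma card_filter_not_heavy_le (hH : ¬ ContainsAsTrace H (matching (s + 1))) (hk : 2 ≤ k)
    (hM : s ≤ M) :
    #{T ∈ tripleCliques H V (k + 1) | ∀ A ∈ heavySets H V k M, ¬ A ⊆ T} ≤
      ((k + 1) * M) ^ (k + 1) := by
  set 𝓕 : Finset (Finset α) :=
    {T ∈ tripleCliques H V (k + 1) | ∀ A ∈ heavySets H V k M, ¬ A ⊆ T} with h𝓕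
  have hcard : ∀ T ∈ 𝓕, #T = k + 1 := fun T hT =>
    (mem_tripleCliques.1 (mem_filter.1 hT).1).1.2
  have := card_filter_superset_le_of_sunflower_le (m := M) hcard ?_ (k + 1) ∅ (by simp)
  · simpa using this
  intro A 𝒮 h𝒮 hA hpair
  rcases 𝒮.eq_empty_or_nonempty with rfl | ⟨T, hT⟩
  · simp
  have hAT := card_lt_card (hA T hT)
  rw [hcard T (h𝒮 hT)] at hAT
  by_cases hAk : #A = k
  · by_contra! hlt
    refine (mem_filter.1 (h𝒮 hT)).2 A (mem_filter.2 ⟨mem_powersetCard.2 ⟨?_, hAk⟩, ?_⟩)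
      (hA T hT).1
    · exact (hA T hT).1.trans (mem_tripleCliques.1 (mem_filter.1 (h𝒮 hT)).1).1.1
    · have hsub : 𝒮 ⊆ (cliqueExtensions H V k A).image (insert · A) := by
        intro T' hT'
        have hc := hcard T' (h𝒮 hT')
        have hmem := (mem_filter.1 (h𝒮 hT')).1
        obtain ⟨v, hv, hvA⟩ := exists_of_ssubset (hA T' hT')
        have heq : insert v A = T' := eq_of_subset_of_card_le
          (insert_subset hv (hA T' hT').1) (by rw [card_insert_of_notMem hvA]; omega)
        refine mem_image.2 ⟨v, mem_filter.2 ⟨?_, hvA, heq ▸ hmem⟩, heq⟩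
        exact (mem_tripleCliques.1 hmem).1.1 hv
      have := (card_le_card hsub).trans card_image_le
      omega
  · exact (card_sunflower_le hH (t := k + 1) (by omega) (by omega)
      (h𝒮.trans (filter_subset _ _)) hpair).trans hM

/-- Each heavy set lies in at most `#V` cliques. -/
lemma card_tripleCliques_le (hH : ¬ ContainsAsTrace H (matching (s + 1))) (hk : 2 ≤ k)
    (hM : s ≤ M) :
    #(tripleCliques H V (k + 1)) ≤
      #(heavySets H V k M) * #V + ((k + 1) * M) ^ (k + 1) := by
  have hcover : tripleCliques H V (k + 1) ⊆
      ((heavySets H V k M).biUnion fun A => V.image (insert · A)) ∪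
        {T ∈ tripleCliques H V (k + 1) | ∀ A ∈ heavySets H V k M, ¬ A ⊆ T} := by
    intro T hT
    by_cases h : ∃ A ∈ heavySets H V k M, A ⊆ T
    · obtain ⟨A, hA, hAT⟩ := h
      obtain ⟨⟨h1, h2⟩, -⟩ := mem_tripleCliques.1 hT
      have h3 := (mem_powersetCard.1 (mem_filter.1 hA).1).2
      obtain ⟨v, hv, hvA⟩ := exists_mem_notMem_of_card_lt_card (by omega : #A < #T)
      refine mem_union_left _ (mem_biUnion.2 ⟨A, hA, mem_image.2 ⟨v, h1 hv, ?_⟩⟩)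
      exact eq_of_subset_of_card_le (insert_subset hv hAT)
        (by rw [card_insert_of_notMem hvA]; omega)
    · push Not at h
      exact mem_union_right _ (mem_filter.2 ⟨hT, h⟩)
  refine (card_le_card hcover).trans ((card_union_le _ _).trans ?_)
  exact Nat.add_le_add (card_biUnion_le_card_mul _ _ _ fun A _ => card_image_le)
    (card_filter_not_heavy_le hH hk hM)

/-- If the heavy sets are all `k`-subsets of a set `U` of `s + 1` vertices, a clique `T` cannot have
two vertices `y, z` outside `U`: complete `{y, z}` to a hyperedge by a vertex `w ∈ T`, and match the
vertices of `U` other than one vertex `u₀` (with `u₀ = w` if `w ∈ U`) with new vertices, using `u₀`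
as the third vertex. -/
lemma card_sdiff_le_one_of_heavySets_eq (hH : ¬ ContainsAsTrace H (matching (s + 1)))
    (hk : 2 ≤ k) (hks : k ≤ s) (hM : 3 * (s + 1) ≤ M) {U : Finset α} (hU : #U = s + 1)
    (hheavy : U.powersetCard k ⊆ heavySets H V k M) {T : Finset α}
    (hT : T ∈ tripleCliques H V (k + 1)) : #(T \ U) ≤ 1 := by
  by_contra! hlt
  obtain ⟨y, hy, z, hz, hyz⟩ := one_lt_card.1 hlt
  obtain ⟨hyT, hyU⟩ := mem_sdiff.1 hy
  obtain ⟨hzT, hzU⟩ := mem_sdiff.1 hz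
  obtain ⟨w, hwT, hw⟩ : ∃ w ∈ T, w ∉ ({y, z} : Finset α) :=
    exists_mem_notMem_of_card_lt_card
      (by rw [card_pair hyz, (mem_tripleCliques.1 hT).1.2]; omega)
  simp only [mem_insert, mem_singleton, not_or] at hw
  obtain ⟨hwy, hwz⟩ := hw
  obtain ⟨u₀, hu₀, hwu₀⟩ : ∃ u₀ ∈ U, w ∈ U → u₀ = w := by
    by_cases hwU : w ∈ U
    · exact ⟨w, hwU, fun _ => rfl⟩
    · obtain ⟨u, hu⟩ := card_pos.1 (by omega : 0 < #U)
      exact ⟨u, hu, fun h => absurd h hwU⟩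
  have hwne : ∀ u ∈ U, u ≠ u₀ → w ≠ u := fun u hu hne h => hne (by rw [hwu₀ (h ▸ hu), h])
  have hsel : ∀ u : U, ∃ A ∈ heavySets H V k M, u.1 ∈ A ∧ u₀ ∈ A := by
    intro u
    obtain ⟨A, h1, h2, h3⟩ := exists_subsuperset_card_eq
      (insert_subset u.2 (singleton_subset_iff.2 hu₀)) (card_le_two.trans hk)
      (by omega : k ≤ #U)
    exact ⟨A, hheavy (mem_powersetCard.2 ⟨h2, h3⟩), h1 (by simp), h1 (by simp)⟩
  choose A hA huA hu₀A using hsel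
  obtain ⟨v, hv, hv'⟩ := exists_injective_extension hA (X := U ∪ {y, z, w}) (by
    have h1 := card_union_le U {y, z, w}
    have h2 : #({y, z, w} : Finset α) ≤ 3 := card_le_three
    rw [Fintype.card_coe]
    omega)
  have hvX : ∀ u, v u ∉ U ∧ v u ≠ y ∧ v u ≠ z ∧ v u ≠ w := by
    intro u
    have := (hv' u).1
    simpa only [mem_union, mem_insert, mem_singleton, not_or] using this
  have hne : ∀ {a c : α}, a ∈ U → c ∉ U → a ≠ c := fun ha hc h => hc (h ▸ ha)
  refine hH (containsAsTrace_matching_of_triples (ι := U) (by simpa using hU)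
    (fun u => if u.1 = u₀ then y else u) (fun u => if u.1 = u₀ then z else v u)
    (fun u => if u.1 = u₀ then w else u₀) ?_ ?_ ?_ ?_ ?_ ?_)
  · intro i j h
    simp only at h
    split_ifs at h with h1 h2 h2
    · exact Subtype.ext (h1.trans h2.symm)
    · exact absurd h.symm (hne j.2 hyU)
    · exact absurd h (hne i.2 hyU)
    · exact Subtype.ext h
  · intro i j h
    simp only at h
    split_ifs at h with h1 h2 h2
    · exact Subtype.ext (h1.trans h2.symm)
    · exact absurd h.symm (hvX j).2.2.1
    · exact absurd h (hvX i).2.2.1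
    · exact hv h
  · intro i j
    split_ifs with h1 h2 h2
    · exact hyz
    · exact (hvX j).2.1.symm
    · exact hne i.2 hzU
    · exact hne i.2 (hvX j).1
  · intro i j
    split_ifs with h1 h2 h2
    · exact hwy
    · exact hwne j j.2 h2
    · exact hne hu₀ hyU
    · exact Ne.symm h2
  · intro i j
    split_ifs with h1 h2 h2
    · exact hwz
    · exact (hvX j).2.2.2.symm
    · exact hne hu₀ hzU
    · exact hne hu₀ (hvX j).1
  · intro i
    split_ifs with h1
    · exact mem_edgeSet_of_mem_tripleCliques hT hyT hzT hwT hyz (Ne.symm hwy) (Ne.symm hwz)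
    · exact mem_edgeSet_of_mem_tripleCliques (hv' i).2.2 (mem_insert_of_mem (huA i))
        (mem_insert_self _ _) (mem_insert_of_mem (hu₀A i)) (hne i.2 (hvX i).1) h1
        (hne hu₀ (hvX i).1).symm

end Heavy

/-! ### The extremal construction -/

section Extremal

variable {α : Type*} {V U : Set α} {hUV : U ⊆ V} {s : ℕ}

lemma isUniform_cliqueConstruction : IsUniform (cliqueConstruction V U hUV) 3 := by
  rintro e (⟨v, hv, p, hp, rfl⟩ | he)
  · rw [Set.encard_insert_of_notMem fun h => hv.2 (hp.1 h), hp.2]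
    norm_num
  · exact he.2

/-- The hyperedges are the triples with at most one vertex outside `U`. -/
lemma eq_of_mem_edgeSet_cliqueConstruction {e : Set α}
    (he : e ∈ (cliqueConstruction V U hUV).edgeSet) {a c : α} (ha : a ∈ e) (hc : c ∈ e)
    (haU : a ∉ U) (hcU : c ∉ U) : a = c := by
  rcases he with ⟨v, hv, p, hp, rfl⟩ | he
  · have h1 : a = v := ha.resolve_right fun h => haU (hp.1 h)
    have h2 : c = v := hc.resolve_right fun h => hcU (hp.1 h)
    rw [h1, h2]
  · exact absurd (he.1 ha) haU

/-- Every edge of the matching meets `U`, so the `s + 1` edges have one vertex in `U` each and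
together contain `U`. The hyperedge inducing such an edge then has two vertices outside `U`. -/
lemma not_containsAsTrace_cliqueConstruction (hU : U.encard = (s + 1 : ℕ)) :
    ¬ ContainsAsTrace (cliqueConstruction V U hUV) (matching (s + 1)) := by
  rintro ⟨S, hS, hScard, K, ⟨hK1, hK2⟩, f, hf, rfl⟩
  have hinj : Function.Injective f := Set.injOn_univ.1 hf
  have hedge : ∀ i, ∃ e ∈ (cliqueConstruction V U hUV).edgeSet, {f (i, 0), f (i, 1)} = e ∩ S := by
    intro i
    have h : f '' {(i, 0), (i, 1)} ∈ ((matching (s + 1)).image f).edgeSet := ⟨_, ⟨i, rfl⟩, rfl⟩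
    rw [Set.image_pair] at h
    exact hK2 h
  choose e he heS using hedge
  have hmem : ∀ i a, f (i, a) ∈ e i := by
    intro i a
    have : f (i, a) ∈ ({f (i, 0), f (i, 1)} : Set α) := by fin_cases a <;> simp
    rw [heS i] at this
    exact this.1
  have hsel : ∀ i, ∃ a, f (i, a) ∈ U := by
    intro i
    by_contra! hcon
    have := eq_of_mem_edgeSet_cliqueConstruction (he i) (hmem i 0) (hmem i 1) (hcon 0) (hcon 1)
    simpa using hinj this
  choose a ha using hsel
  -- the chosen vertices exhaust `U`
  have hginj : Function.Injective fun i => f (i, a i) := fun i j h => (Prod.ext_iff.1 (hinj h)).1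
  have hrange : Set.range (fun i => f (i, a i)) = U := by
    refine (Set.finite_range _).eq_of_subset_of_encard_le ?_ ?_
    · rintro _ ⟨i, rfl⟩
      exact ha i
    · rw [hU, ← Set.image_univ, hginj.injOn.encard_image, Set.encard_univ]
      simp
  have hUS : U ⊆ S := by
    rw [← hrange]
    rintro _ ⟨i, rfl⟩
    exact hK1 ⟨(i, a i), trivial, rfl⟩
  obtain ⟨w, hw, hwS⟩ : ∃ w ∈ e 0, w ∉ S := by
    by_contra! hcon
    have h1 := isUniform_cliqueConstruction (e 0) (he 0)
    rw [← Set.inter_eq_left.2 hcon, ← heS 0] at h1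
    have h2 := Set.encard_insert_le {f (0, 1)} (f (0, 0))
    rw [h1, Set.encard_singleton] at h2
    norm_num at h2
  have hboth : ∀ c, f (0, c) ∈ U := by
    intro c
    by_contra hc
    have := eq_of_mem_edgeSet_cliqueConstruction (he 0) (hmem 0 c) hw hc fun h => hwS (hUS h)
    exact hwS (this ▸ hK1 ⟨(0, c), trivial, rfl⟩)
  have hval : ∀ c, c = a 0 := by
    intro c
    have h := hboth c
    rw [← hrange] at h
    obtain ⟨j, hj⟩ := h
    obtain ⟨h1, h2⟩ := Prod.ext_iff.1 (hinj hj)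
    simp only at h1 h2
    rw [← h2, h1]
  exact absurd ((hval 0).trans (hval 1).symm) (by decide)

lemma tripleCliques_cliqueConstruction {V U : Finset α} (hUV : (U : Set α) ⊆ V) {k : ℕ}
    (hk : 2 ≤ k) :
    tripleCliques (cliqueConstruction V U hUV) V (k + 1) =
      {T ∈ V.powersetCard (k + 1) | #(T \ U) ≤ 1} := by
  ext T
  rw [mem_tripleCliques, mem_filter, mem_powersetCard]
  refine and_congr_right fun hT => ⟨fun h => ?_, fun h e he hcard => ?_⟩
  · by_contra! hlt
    obtain ⟨y, hy, z, hz, hyz⟩ := one_lt_card.1 hlt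
    obtain ⟨hyT, hyU⟩ := mem_sdiff.1 hy
    obtain ⟨hzT, hzU⟩ := mem_sdiff.1 hz
    obtain ⟨e, h1, h2, h3⟩ := exists_subsuperset_card_eq
      (insert_subset hyT (singleton_subset_iff.2 hzT)) (n := 3)
      (card_le_two.trans (by norm_num)) (by omega)
    refine hyz (eq_of_mem_edgeSet_cliqueConstruction (h e h2 h3) (a := y) (c := z) ?_ ?_ ?_ ?_)
    · exact mem_coe.2 (h1 (by simp))
    · exact mem_coe.2 (h1 (by simp))
    · exact_mod_cast hyU
    · exact_mod_cast hzU
  · by_cases heU : e ⊆ U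
    · exact Or.inr ⟨by exact_mod_cast heU, by rw [Set.encard_coe_eq_coe_finsetCard, hcard]⟩
    · obtain ⟨v, hve, hvU⟩ := not_subset.1 heU
      have hvV : v ∈ (V : Set α) \ U := ⟨mem_coe.2 (hT.1 (he hve)), fun h => hvU (mem_coe.1 h)⟩
      refine Or.inl ⟨v, hvV, (e.erase v : Finset α), ⟨fun y hy => ?_, ?_⟩, ?_⟩
      · have hye := mem_coe.1 hy
        by_contra hyU
        refine ne_of_mem_erase hye (card_le_one.1 h y (mem_sdiff.2 ⟨?_, fun h => hyU (mem_coe.2 h)⟩)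
          v (mem_sdiff.2 ⟨he hve, hvU⟩))
        exact he (mem_of_mem_erase hye)
      · rw [Set.encard_coe_eq_coe_finsetCard, card_erase_of_mem hve, hcard]
      · rw [← coe_insert, insert_erase hve]

end Extremal

end TraceTuran

open Finset TraceTuran in
theorem theorem1p5 (s t : ℕ) (ht : 4 ≤ t) (hts : t ≤ s) :
    (∃ N : ℕ, ∀ n : ℕ, N ≤ n → ∀ (α : Type u) (H : Hypergraph α),
      H.vertexSet.encard = n → TraceTuran.IsUniform H 3 →
      ¬ TraceTuran.ContainsAsTrace H (TraceTuran.matching (s + 1)) →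
      TraceTuran.numCopies (TraceTuran.completeUniform t 3) H ≤
        (s + 1).choose (t - 1) * (n - (s + 1)) + (s + 1).choose t) ∧
    (∀ n : ℕ, s + 1 ≤ n → ∀ (α : Type u) (V U : Set α) (hUV : U ⊆ V),
      V.encard = n → U.encard = (s + 1 : ℕ) →
      TraceTuran.IsUniform (TraceTuran.cliqueConstruction V U hUV) 3 ∧
      ¬ TraceTuran.ContainsAsTrace (TraceTuran.cliqueConstruction V U hUV)
        (TraceTuran.matching (s + 1)) ∧
      TraceTuran.numCopies (TraceTuran.completeUniform t 3)
          (TraceTuran.cliqueConstruction V U hUV) =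
        (s + 1).choose (t - 1) * (n - (s + 1)) + (s + 1).choose t) := by
  obtain ⟨m, rfl⟩ : ∃ m, t = m + 1 + 1 := ⟨t - 2, by omega⟩
  rw [Nat.add_sub_cancel]
  refine ⟨⟨((m + 1 + 1) * (3 * (s + 1))) ^ (m + 1 + 1) + (s + 1).choose (m + 1) * (s + 1),
    fun n hn α H hV _ hH => ?_⟩, fun n hn α V U hUV hV hU =>
    ⟨isUniform_cliqueConstruction, not_containsAsTrace_cliqueConstruction hU, ?_⟩⟩
  · obtain ⟨V, hVeq⟩ := (Set.finite_of_encard_eq_coe hV).exists_finset_coe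
    rw [← hVeq, Set.encard_coe_eq_coe_finsetCard, Nat.cast_inj] at hV
    rw [numCopies_completeUniform hVeq.symm]
    have hstar := starForestBound_heavyGraph (V := V) (k := m + 1) hH le_rfl
    obtain ⟨hle, heq⟩ := hstar.card_cliquesIn_le (m := m) (by omega)
    have hsub := heavySets_subset_cliquesIn (H := H) (V := V) (k := m + 1) (M := 3 * (s + 1))
    have hheavy := card_le_card hsub
    by_cases hlt : #(heavySets H V (m + 1) (3 * (s + 1))) < (s + 1).choose (m + 1)
    · -- the leading coefficient is smaller than the one of the bound
      have hF := card_tripleCliques_le (V := V) (k := m + 1) (M := 3 * (s + 1)) hH (by omega)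
        (by omega)
      rw [hV] at hF
      obtain ⟨c, hc⟩ := Nat.exists_eq_add_of_lt hlt
      have hmul : (s + 1).choose (m + 1) * n =
          (s + 1).choose (m + 1) * (n - (s + 1)) + (s + 1).choose (m + 1) * (s + 1) := by
        have hpos := Nat.choose_pos (show m + 1 ≤ s + 1 by omega)
        have : s + 1 ≤ n := by nlinarith
        rw [← Nat.mul_add, Nat.sub_add_cancel this]
      have hmul' : #(heavySets H V (m + 1) (3 * (s + 1))) * n + n ≤
          (s + 1).choose (m + 1) * n := by
        rw [← Nat.succ_mul]
        exact Nat.mul_le_mul_right n hlt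
      omega
    · obtain ⟨U, hUV, hU, hcl⟩ := heq (by omega) (by omega)
      have hall : U.powersetCard (m + 1) ⊆ heavySets H V (m + 1) (3 * (s + 1)) := by
        have h1 : heavySets H V (m + 1) (3 * (s + 1)) ⊆ U.powersetCard (m + 1) := fun A hA =>
          mem_powersetCard.2 ⟨hcl A (hsub hA), (mem_cliquesIn.1 (hsub hA)).1.2⟩
        rw [eq_of_subset_of_card_le h1 (by rw [card_powersetCard, hU]; omega)]
      rw [← hV, ← hU, ← card_filter_card_sdiff_le_one hUV]
      refine card_le_card fun T hT => mem_filter.2 ⟨?_, ?_⟩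
      · exact mem_powersetCard.2 (mem_tripleCliques.1 hT).1
      · convert card_sdiff_le_one_of_heavySets_eq hH (by omega) (by omega) le_rfl hU hall hT
  · obtain ⟨V, rfl⟩ := (Set.finite_of_encard_eq_coe hV).exists_finset_coe
    obtain ⟨U, rfl⟩ := (Set.finite_of_encard_eq_coe hU).exists_finset_coe
    rw [Set.encard_coe_eq_coe_finsetCard, Nat.cast_inj] at hV hU
    rw [numCopies_completeUniform (V := V) rfl, tripleCliques_cliqueConstruction hUV (by omega),
      card_filter_card_sdiff_le_one (by exact_mod_cast hUV), hV, hU]
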